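/- **Setting.** All circuits are Boolean circuits with arbitrary binary gates and unbounded fan-out; constants and wiring are free. The running time of a circuit is its number of gates. The elements of a (finite) set $Y$ are represented by $m$-bit strings via a fixed injection $\mathrm{enc}\colon Y\to\{0,1\}^m$. Random variables $P,Q$ over $Y$ are *$(T,\beta)$-computationally indistinguishable* if $|\Pr[D(P)=1]-\Pr[D(Q)=1]|\le\beta$ for every test $D\colon Y\to\{0,1\}$ that is computed (on encoded inputs) by a circuit of size at most $T$. A function $G\colon\{0,1\}^\ell\to\{0,1\}^t$ is a *$(T,\beta)$-PRG* if $G(s)$, for uniform $s\in\{0,1\}^\ell$, is $(T,\beta)$-computationally indistinguishable from a uniform element of $\{0,1\}^t$. Distributions $\mu,\nu$ on a set are *$\varepsilon$-close* if $e^{-\varepsilon}\mu(E)\le\nu(E)\le e^{\varepsilon}\mu(E)$ for all subsets $E$. A randomized map $\mathcal R\colon X\to Y$ is a *deletion $\varepsilon$-DP local randomizer* if there is a (reference) distribution $\rho$ on $Y$ such that $\mathcal R(x)$ is $\varepsilon$-close to $\rho$ for all $x\in X$; it is *$t$-samplable* if there is $\mathcal R_\emptyset\colon\{0,1\}^t\to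 Y$ such that $\mathcal R_\emptyset(r)$, for uniform $r$, has the distribution $\rho$. For $\varepsilon\ge 0$, $\gamma>0$, the *compressor* $\mathcal R[G,\gamma]$ is the following algorithm on input $x\in X$. For $j=1,\dots,\max(1,\lceil e^\varepsilon\ln(1/\gamma)\rceil)$: draw a uniform seed $s\in\{0,1\}^\ell$, let $y=\mathcal R_\emptyset(G(s))$, draw a bit $b$ that is $1$ with probability $$\frac{\Pr[\mathcal R(x)=y]}{e^\varepsilon\Pr_{r}[\mathcal R_\emptyset(r)=y]},$$ and leave the loop if $b=1$. Finally output the last drawn $s$. Given a circuit for $G$, a circuit for $\mathcal R_\emptyset$ (with encoded output) and, for every $x$, a randomized circuit (a circuit with additional random input bits of an arbitrary distribution) that draws $b$ from $y$, the algorithm is implemented by the randomized circuit that unrolls the loop; each round consists of these three circuits, one gate that updates the flag "loop left", and a selector for the seed. The running time $T(\mathcal R,G,\gamma)$ is (any upper bound, over all $x\in X$, on) the size of this circuit. **Theorem.** Let $\varepsilon\ge 0$, let $\mathcal R\colon X\to Y$ be a deletion $\varepsilon$-DP, $t$-samplable local randomizer with reference distribution $\rho$ sampled by $\mathcal R_\emptyset$,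 let $G\colon\{0,1\}^\ell\to\{0,1\}^t$ be a $(T,\beta)$-PRG with $\beta<1/(2e^\varepsilon)$, and let $\gamma>0$. Fix any implementation of $\mathcal R[G,\gamma]$ as above, let $T(\mathcal R,G,\gamma)$ be its running time, and assume $T>T(\mathcal R,G,\gamma)$. Then $\mathcal R[G,\gamma]$ is a deletion $(\varepsilon+2e^\varepsilon\beta)$-DP local randomizer. Moreover, for all $x\in X$, $\mathcal R_\emptyset(G(\mathcal R[G,\gamma](x)))$ is $(T',\beta')$-computationally indistinguishable from $\mathcal R(x)$, where $T'=T-T(\mathcal R,G,\gamma)$ and $\beta'=\gamma+e^\varepsilon\ln(1/\gamma)\,\beta$. -/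

import Mathlib

open scoped ENNReal

/-! ## Boolean circuits -/

/-- Bit strings of length `n`. -/
abbrev Bits (n : ℕ) : Type := Fin n → Bool

/-- Boolean circuits with input wires `ι` and output wires `κ`, built from arbitrary binary gates.
`wire` routes, copies (unbounded fan-out) and drops wires and supplies the constants `0`, `1`;
`seq` and `par` are sequential and parallel composition. -/
inductive Circuit : Type → Type → Type 1
  | wire {ι κ : Type} (f : κ → ι ⊕ Bool) : Circuit ι κ
  | gate (op : Bool → Bool → Bool) : Circuit (Fin 2) (Fin 1)
  | seq {ι κ μ : Type} (C : Circuit ι κ) (D : Circuit κ μ) : Circuit ι μ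
  | par {ι κ ι' κ' : Type} (C : Circuit ι κ) (D : Circuit ι' κ') : Circuit (ι ⊕ ι') (κ ⊕ κ')

namespace Circuit

/-- The function computed by a circuit. -/
def eval {ι κ : Type} (C : Circuit ι κ) : (ι → Bool) → (κ → Bool) :=
  match C with
  | wire f => fun a j => Sum.elim a id (f j)
  | gate op => fun a _ => op (a 0) (a 1)
  | seq C D => fun a => D.eval (C.eval a)
  | par C D => fun a =>
      Sum.elim (C.eval fun i => a (Sum.inl i)) (D.eval fun i => a (Sum.inr i))

/-- The size of a circuit is its number of gates. This is the running time of a circuit. -/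
def size {ι κ : Type} (C : Circuit ι κ) : ℕ :=
  match C with
  | wire _ => 0
  | gate _ => 1
  | seq C D => C.size + D.size
  | par C D => C.size + D.size

/-- The circuit that copies its input to its output. -/
def idle (ι : Type) : Circuit ι ι := wire Sum.inl

/-- For the pair `(f, b)`, the bit `f ∨ b`. -/
def orGate : Circuit (Fin 1 ⊕ Fin 1) (Fin 1) :=
  seq (wire ![Sum.inl (Sum.inl 0), Sum.inl (Sum.inr 0)]) (gate or)

/-- One-bit selector: on `(f, u, v)` the bit `u` if `f = 1` and the bit `v` if `f = 0`,
computed as `(f ∧ u) ∨ (¬ f ∧ v)`. -/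
def select1 : Circuit (Fin 3) (Fin 1) :=
  seq (wire (Sum.elim ![Sum.inl 0, Sum.inl 1] ![Sum.inl 0, Sum.inl 2]))
    (seq (par (gate and) (gate fun f v => !f && v)) orGate)

/-- Selector for `n`-bit strings: on `(f, (u, v))` the string `u` if `f = 1` and `v` if `f = 0`. -/
def select : (n : ℕ) → Circuit (Fin 1 ⊕ (Fin n ⊕ Fin n)) (Fin n)
  | 0 => wire Fin.elim0
  | n + 1 =>
    seq (wire (Sum.elim
        ![Sum.inl (Sum.inl 0), Sum.inl (Sum.inr (Sum.inl 0)), Sum.inl (Sum.inr (Sum.inr 0))]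
        (Sum.elim (fun _ => Sum.inl (Sum.inl 0))
          (Sum.elim (fun i => Sum.inl (Sum.inr (Sum.inl (Fin.succ i))))
            (fun i => Sum.inl (Sum.inr (Sum.inr (Fin.succ i))))))))
      (seq (par select1 (select n))
        (wire (Fin.cases (Sum.inl (Sum.inl 0)) fun i => Sum.inl (Sum.inr i))))

theorem eval_select1 (a : Fin 3 → Bool) : select1.eval a 0 = bif a 0 then a 1 else a 2 := by
  simp only [select1, orGate, eval]
  cases h0 : a 0 <;> simp [h0]

theorem eval_select (n : ℕ) (f : Fin 1 → Bool) (u v : Bits n) :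
    (select n).eval (Sum.elim f (Sum.elim u v)) = bif f 0 then u else v := by
  induction n with
  | zero => exact funext fun i => i.elim0
  | succ n ih =>
    funext i
    refine Fin.cases ?_ (fun i => ?_) i
    · simp only [select, eval, Fin.cases_zero, Sum.elim_inl, eval_select1]
      cases h : f 0 <;> simp [h]
    · have := congrFun (ih (fun i => u i.succ) (fun i => v i.succ)) i
      simp only [select, eval, Fin.cases_succ, Sum.elim_inl, Sum.elim_inr]
      convert this using 2
      · funext j
        rcases j with j | j | j
        · simp [Subsingleton.elim j 0]
        · simp
        · simp
      · cases h : f 0 <;> simp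

end Circuit

/-! ## Indistinguishability and pseudorandom generators -/

/-- The probability of the event `E` under `μ`. -/
noncomputable def prob {α : Type*} (μ : PMF α) (E : Set α) : ℝ := (μ.toOuterMeasure E).toReal

/-- `P` and `Q` are `(𝒟, β)`-indistinguishable. -/
def Indistinguishable {Y : Type*} (𝒟 : Set (Y → Bool)) (β : ℝ) (P Q : PMF Y) : Prop :=
  ∀ D ∈ 𝒟, |prob P {y | D y = true} - prob Q {y | D y = true}| ≤ β

/-- The tests on `Y` computed, on the bit representation `enc` of the elements of `Y`, by Boolean
circuits of size at most `T`. -/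
def testsInTime {Y : Type*} {m : ℕ} (enc : Y ↪ Bits m) (T : ℕ) : Set (Y → Bool) :=
  {D | ∃ C : Circuit (Fin m) (Fin 1), C.size ≤ T ∧ ∀ y, C.eval (enc y) 0 = D y}

/-- `(T, β)`-computational indistinguishability. -/
def CompIndistinguishable {Y : Type*} {m : ℕ} (enc : Y ↪ Bits m) (T : ℕ) (β : ℝ) (P Q : PMF Y) :
    Prop :=
  Indistinguishable (testsInTime enc T) β P Q

/-- The uniform distribution on `{0,1}ⁿ`. -/
noncomputable def uniformBits (n : ℕ) : PMF (Bits n) := PMF.uniformOfFintype (Bits n)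

/-- `G` is a `(T, β)`-PRG: it `β`-fools all tests on `{0,1}ᵗ` running in time `T`. -/
def IsPRG {l t : ℕ} (G : Bits l → Bits t) (T : ℕ) (β : ℝ) : Prop :=
  CompIndistinguishable (Function.Embedding.refl (Bits t)) T β
    ((uniformBits l).map G) (uniformBits t)

/-! ## Local randomizers -/

/-- `(ε, δ)`-closeness of two distributions. -/
def Close {Y : Type*} (ε δ : ℝ) (μ ν : PMF Y) : Prop :=
  ∀ E : Set Y, Real.exp (-ε) * (prob μ E - δ) ≤ prob ν E ∧
    prob ν E ≤ Real.exp ε * prob μ E + δ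

/-- `R` is a deletion `(ε, δ)`-DP local randomizer with reference distribution `ρ`. -/
def IsDeletionDPWith {X Y : Type*} (R : X → PMF Y) (ρ : PMF Y) (ε δ : ℝ) : Prop :=
  ∀ x, Close ε δ (R x) ρ

/-- `R` is a deletion `(ε, δ)`-DP local randomizer. -/
def IsDeletionDP {X Y : Type*} (R : X → PMF Y) (ε δ : ℝ) : Prop :=
  ∃ ρ : PMF Y, IsDeletionDPWith R ρ ε δ

/-- The distribution of `R₀ r` for uniformly random `r`. -/
noncomputable def sampled {Y : Type*} {t : ℕ} (R₀ : Bits t → Y) : PMF Y := (uniformBits t).map R₀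

/-! ## The rejection-sampling compressor -/

/-- The Bernoulli distribution with parameter `p` (parameters above `1` are read as `1`). -/
noncomputable def bern (p : ℝ≥0∞) : PMF Bool :=
  PMF.ofFintype (fun b => bif b then min p 1 else 1 - min p 1) (by
    simp [add_tsub_cancel_of_le])

/-- The acceptance probability `Pr[R(x) = y] / (e^ε · Pr_r[R₀(r) = y])`. -/
noncomputable def acceptProb {X Y : Type*} {t : ℕ} (R : X → PMF Y) (R₀ : Bits t → Y) (ε : ℝ)
    (x : X) (y : Y) : ℝ≥0∞ :=
  R x y / (ENNReal.ofReal (Real.exp ε) * sampled R₀ y)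

/-- The `for` loop with `n` rounds to go, where `s` is the seed currently held: draw a new seed `s'`
and a bit `b`, leave the loop with `s'` if `b = 1` and go on with `s'` otherwise. At the end of the
loop the seed held is sent. -/
noncomputable def rejectionLoop {X Y : Type*} {l t : ℕ} (R : X → PMF Y) (R₀ : Bits t → Y)
    (G : Bits l → Bits t) (ε : ℝ) (x : X) : ℕ → Bits l → PMF (Bits l)
  | 0, s => PMF.pure s
  | n + 1, _ =>
    (uniformBits l).bind fun s' =>
      (bern (acceptProb R R₀ ε x (R₀ (G s')))).bind fun b =>
        bif b then PMF.pure s' else rejectionLoop R R₀ G ε x n s'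

/-- The number of rounds: `J = e^ε ln(1/γ)` rounded up, and at least one, so that some seed is
drawn. -/
noncomputable def rounds (ε γ : ℝ) : ℕ := max 1 ⌈Real.exp ε * Real.log (1 / γ)⌉₊

/-- The local randomizer `R[G,γ]`. As there is at least one round, the initial value of the seed
does not matter. -/
noncomputable def compressor {X Y : Type*} {l t : ℕ} (R : X → PMF Y) (R₀ : Bits t → Y)
    (G : Bits l → Bits t) (ε γ : ℝ) (x : X) : PMF (Bits l) :=
  rejectionLoop R R₀ G ε x (rounds ε γ) fun _ => false

/-! ## The running time of the compressor -/

/-- Boolean circuits for the three steps of a round of `R[G,γ]`: computing `G`, computing `R₀`, and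
sampling a bit from the Bernoulli distribution with parameter `acceptProb R R₀ ε x y`. The last one
is a randomized circuit: it reads `y` and `coins x` random bits, which have the distribution
`coinLaw x` (not necessarily uniform, as the parameter is an arbitrary real number). The input `x`
may be hard-wired in this circuit (constants are free of charge, so this covers circuits that read
an encoding of `x`). -/
structure Implementation {X Y : Type*} {l t m : ℕ} (R : X → PMF Y) (R₀ : Bits t → Y)
    (G : Bits l → Bits t) (ε : ℝ) (enc : Y ↪ Bits m) where
  /-- the circuit for `G` -/
  genCircuit : Circuit (Fin l) (Fin t)
  eval_genCircuit : ∀ s, genCircuit.eval s = G s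
  /-- the circuit for `R₀` -/
  refCircuit : Circuit (Fin t) (Fin m)
  eval_refCircuit : ∀ r, refCircuit.eval r = enc (R₀ r)
  /-- the number of random bits of the Bernoulli sampler -/
  coins : X → ℕ
  /-- the distribution of these random bits -/
  coinLaw : ∀ x, PMF (Bits (coins x))
  /-- the circuit of the Bernoulli sampler -/
  bernCircuit : ∀ x, Circuit (Fin m ⊕ Fin (coins x)) (Fin 1)
  law_bernCircuit : ∀ x r,
    (coinLaw x).map (fun w => (bernCircuit x).eval (Sum.elim (enc (R₀ r)) w) 0) =
      bern (acceptProb R R₀ ε x (R₀ r))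

namespace Implementation

variable {X Y : Type*} {l t m : ℕ} {R : X → PMF Y} {R₀ : Bits t → Y} {G : Bits l → Bits t} {ε : ℝ}
  {enc : Y ↪ Bits m} (I : Implementation R R₀ G ε enc)

/-- From a seed and the random bits of the sampler: `y := R₀ (G s)`, then the bit `b`. -/
def bitCircuit (x : X) : Circuit (Fin l ⊕ Fin (I.coins x)) (Fin 1) :=
  .seq (.par (.seq I.genCircuit I.refCircuit) (.idle (Fin (I.coins x)))) (I.bernCircuit x)

/-- One round. The state is a pair `(f, s)`: `f` tells whether the loop has been left, and `s` is
the seed held. With a fresh seed `s'` and the bit `b` computed from it, the new state is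
`(f ∨ b, if f then s else s')`. -/
def roundCircuit (x : X) :
    Circuit ((Fin 1 ⊕ Fin l) ⊕ (Fin l ⊕ Fin (I.coins x))) (Fin 1 ⊕ Fin l) :=
  .seq
    (.wire (Sum.elim
      (Sum.elim (fun i => Sum.inl (Sum.inl (Sum.inl i))) (fun j => Sum.inl (Sum.inr j)))
      (Sum.elim (fun i => Sum.inl (Sum.inl (Sum.inl i)))
        (Sum.elim (fun i => Sum.inl (Sum.inl (Sum.inr i)))
          (fun i => Sum.inl (Sum.inr (Sum.inl i))))) :
        (Fin 1 ⊕ (Fin l ⊕ Fin (I.coins x))) ⊕ (Fin 1 ⊕ (Fin l ⊕ Fin l)) → _))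
    (.par (.seq (.par (.idle (Fin 1)) (I.bitCircuit x)) .orGate) (.select l))

/-- The unrolled loop of `n` rounds, reading fresh random bits in every round. -/
def loopCircuit (x : X) :
    (n : ℕ) → Circuit ((Fin 1 ⊕ Fin l) ⊕ Fin n × (Fin l ⊕ Fin (I.coins x))) (Fin 1 ⊕ Fin l)
  | 0 => .wire fun j => Sum.inl (Sum.inl j)
  | n + 1 =>
    .seq
      (.wire (Sum.elim
        (Sum.elim (fun i => Sum.inl (Sum.inl i)) (fun j => Sum.inl (Sum.inr (0, j))))
        (fun p => Sum.inl (Sum.inr (p.1.succ, p.2))) :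
          ((Fin 1 ⊕ Fin l) ⊕ (Fin l ⊕ Fin (I.coins x))) ⊕
            Fin n × (Fin l ⊕ Fin (I.coins x)) → _))
      (.seq (.par (I.roundCircuit x) (.idle (Fin n × (Fin l ⊕ Fin (I.coins x)))))
        (loopCircuit x n))

/-- The circuit that runs `R[G,γ]` on `x`: from its random bits it computes the seed to be sent. -/
noncomputable def circuit (γ : ℝ) (x : X) :
    Circuit (Fin (rounds ε γ) × (Fin l ⊕ Fin (I.coins x))) (Fin l) :=
  .seq (.wire (Sum.elim (fun _ => Sum.inr false) (fun p => Sum.inl p)))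
    (.seq (I.loopCircuit x (rounds ε γ)) (.wire fun i => Sum.inl (Sum.inr i)))

/-- `T` bounds the running time of `R[G,γ]` on all inputs. -/
def RunsInTime (γ : ℝ) (T : ℕ) : Prop := ∀ x, (I.circuit γ x).size ≤ T

/-- The random bits of `n` independent rounds: in each round a uniform seed and the random bits of
the Bernoulli sampler. -/
noncomputable def randomBits (x : X) :
    (n : ℕ) → PMF (Fin n × (Fin l ⊕ Fin (I.coins x)) → Bool)
  | 0 => PMF.pure fun _ => false
  | n + 1 =>
    (uniformBits l).bind fun s => (I.coinLaw x).bind fun w => (randomBits x n).bind fun a =>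
      PMF.pure fun p => Fin.cases (Sum.elim s w p.2) (fun i => a (i, p.2)) p.1

theorem eval_bitCircuit (x : X) (s : Bits l) (w : Bits (I.coins x)) :
    (I.bitCircuit x).eval (Sum.elim s w) 0 =
      (I.bernCircuit x).eval (Sum.elim (enc (R₀ (G s))) w) 0 := by
  simp only [bitCircuit, Circuit.eval, Circuit.idle, Sum.elim_inl, Sum.elim_inr,
    I.eval_genCircuit, I.eval_refCircuit]

theorem eval_roundCircuit (x : X) (f : Fin 1 → Bool) (u s : Bits l) (w : Bits (I.coins x)) :
    (I.roundCircuit x).eval (Sum.elim (Sum.elim f u) (Sum.elim s w)) =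
      Sum.elim (fun _ => f 0 || (I.bitCircuit x).eval (Sum.elim s w) 0)
        (bif f 0 then u else s) := by
  rw [← Circuit.eval_select]
  simp only [roundCircuit, Circuit.eval, Circuit.idle, Circuit.orGate]
  congr 1
  congr 1
  funext j
  rcases j with j | j | j <;> rfl

theorem law_loopCircuit (x : X) (n : ℕ) (f : Fin 1 → Bool) (u : Bits l) :
    (I.randomBits x n).map
        (fun a i => (I.loopCircuit x n).eval (Sum.elim (Sum.elim f u) a) (Sum.inr i)) =
      bif f 0 then PMF.pure u else rejectionLoop R R₀ G ε x n u := by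
  induction n generalizing f u with
  | zero => simp [randomBits, loopCircuit, Circuit.eval, rejectionLoop, PMF.pure_map]
  | succ n ih =>
    have key : ∀ (s : Bits l) (w : Bits (I.coins x))
        (a : Fin n × (Fin l ⊕ Fin (I.coins x)) → Bool),
        (I.loopCircuit x (n + 1)).eval (Sum.elim (Sum.elim f u)
            fun p => Fin.cases (Sum.elim s w p.2) (fun i => a (i, p.2)) p.1) =
          (I.loopCircuit x n).eval (Sum.elim (Sum.elim
            (fun _ => f 0 || (I.bernCircuit x).eval (Sum.elim (enc (R₀ (G s))) w) 0)
            (bif f 0 then u else s)) a) := by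
      intro s w a
      rw [← eval_bitCircuit, ← eval_roundCircuit]
      simp only [loopCircuit, Circuit.eval, Circuit.idle]
      congr 1
      congr 1
      congr 1
      funext j
      rcases j with (j | j) | j <;> rfl
    simp only [randomBits, PMF.map_bind, PMF.pure_map, key]
    have h2 : ∀ (s : Bits l) (w : Bits (I.coins x)),
        ((I.randomBits x n).bind fun a => PMF.pure fun i =>
          (I.loopCircuit x n).eval (Sum.elim (Sum.elim
            (fun _ => f 0 || (I.bernCircuit x).eval (Sum.elim (enc (R₀ (G s))) w) 0)
            (bif f 0 then u else s)) a) (Sum.inr i)) =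
        bif (f 0 || (I.bernCircuit x).eval (Sum.elim (enc (R₀ (G s))) w) 0)
          then PMF.pure (bif f 0 then u else s)
          else rejectionLoop R R₀ G ε x n (bif f 0 then u else s) := fun s w => ih _ _
    simp only [h2]
    cases h : f 0
    · simp only [Bool.false_or, cond_false, rejectionLoop, ← I.law_bernCircuit, PMF.bind_map]
      rfl
    · simp

/-- On its random bits, the circuit computes a sample of `R[G,γ](x)`. -/
theorem law_circuit (γ : ℝ) (x : X) :
    (I.randomBits x (rounds ε γ)).map (I.circuit γ x).eval = compressor R R₀ G ε γ x := by
  have h := I.law_loopCircuit x (rounds ε γ) (fun _ => false) (fun _ => false)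
  simp only [cond_false] at h
  rw [compressor, ← h]
  congr 1
  funext a i
  simp only [circuit, Circuit.eval, Sum.elim_inl]
  congr 2
  funext j
  rcases j with (j | j) | j <;> rfl

end Implementation

/-!
Write `p` for the acceptance probability, as a function of the string `r` from which `R₀` computes
`y`, and `a = e^{-ε}`. Closeness of `R x` to the reference distribution says that `p` takes its
values in `[e^{-2ε}, 1]`, and on a truly random `r` acceptance reweights the reference distribution
to `a • R x` (`expect_acceptProb_mul`); in particular such a round accepts with probability `a`.

Computational part: once its coins are fixed, the Bernoulli sampler is a circuit, so `G` fools every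
function `op b d` of the acceptance bit `b` and of the verdict `d` of a small test on `y`. This is
one round's worth of computation, which the running time of the compressor pays for. Averaging over
the coins gives `Implementation.abs_expect_sub_le_of_op`, and mixing two choices of `op` gives
`Implementation.abs_expect_sub_le_of_value`: `G` fools the value of a round that is worth `d` on
acceptance and a constant `v ∈ [0, 1]` on rejection. All of the analysis below uses these
single-round facts and the recursion `expect_rejectionLoop_succ_succ` for the expectation of a
function of the output.

Privacy: with seeds expanded by `G`, a round accepts with a probability `a'` within `β` of `a`. By
the recursion, the density of the output against the uniform seed is a convex combination of `1` and
`p / a'`, hence within `e^{±(ε + 2 e^ε β)}` because `e^ε β ≤ 1/2` (`expect_rejectionLoop_bounds`).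

Utility: let `q` be the acceptance probability of a test on `R x`, and `V n` the one on the output of
`n` rounds. On truly random `r`, a round with continuation value `V n` is worth
`q + (1 - a) * (V n - q)`, so `|V (n + 1) - q| ≤ β + (1 - a) * |V n - q|`. Summing the geometric
series bounds the error after `J` rounds by `c + e^ε β (1 - c)` with `c = (1 - a) ^ J ≤ γ`
(`abs_expect_rejectionLoop_sub_le`). Keeping the factor `1 - a` matters: a plain union bound would
cost `J β`, which can exceed `e^ε ln(1/γ) β` because `J` is rounded up. The bound increases with `c`,
and `1 - γ ≤ ln(1/γ)`.
-/

/-! ### Expectations over finite types -/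

/-- The expectation of `f` under a distribution `μ` on a finite type. -/
noncomputable def expect {α : Type*} [Fintype α] (μ : PMF α) (f : α → ℝ) : ℝ :=
  ∑ a, (μ a).toReal * f a

section Expectation

variable {α β : Type*} [Fintype α] [Fintype β]

theorem sum_toReal_eq_one (μ : PMF α) : ∑ a, (μ a).toReal = 1 := by
  rw [← ENNReal.toReal_sum fun a _ => μ.apply_ne_top a, ← tsum_fintype (L := .unconditional _),
    μ.tsum_coe, ENNReal.toReal_one]

theorem expect_const (μ : PMF α) (c : ℝ) : expect μ (fun _ => c) = c := by
  rw [expect, ← Finset.sum_mul, sum_toReal_eq_one, one_mul]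

theorem expect_add (μ : PMF α) (f g : α → ℝ) :
    expect μ (fun a => f a + g a) = expect μ f + expect μ g := by
  simp only [expect, mul_add, Finset.sum_add_distrib]

theorem expect_sub (μ : PMF α) (f g : α → ℝ) :
    expect μ (fun a => f a - g a) = expect μ f - expect μ g := by
  simp only [expect, mul_sub, Finset.sum_sub_distrib]

theorem expect_const_mul (μ : PMF α) (c : ℝ) (f : α → ℝ) :
    expect μ (fun a => c * f a) = c * expect μ f := by
  simp only [expect, Finset.mul_sum, mul_left_comm]

theorem expect_mul_add_one_sub_mul (μ : PMF α) (p f : α → ℝ) (v : ℝ) :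
    expect μ (fun a => p a * f a + (1 - p a) * v) =
      expect μ (fun a => p a * f a) + (1 - expect μ p) * v := by
  simp only [mul_comm _ v]
  rw [expect_add, expect_const_mul, expect_sub, expect_const]

theorem expect_mono (μ : PMF α) {f g : α → ℝ} (h : ∀ a, f a ≤ g a) : expect μ f ≤ expect μ g :=
  Finset.sum_le_sum fun a _ => mul_le_mul_of_nonneg_left (h a) ENNReal.toReal_nonneg

theorem expect_nonneg (μ : PMF α) {f : α → ℝ} (h : ∀ a, 0 ≤ f a) : 0 ≤ expect μ f :=
  Finset.sum_nonneg fun a _ => mul_nonneg ENNReal.toReal_nonneg (h a)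

theorem expect_le_one (μ : PMF α) {f : α → ℝ} (h : ∀ a, f a ≤ 1) : expect μ f ≤ 1 :=
  (expect_mono μ h).trans_eq (expect_const μ 1)

theorem abs_expect_le (μ : PMF α) {f : α → ℝ} {c : ℝ} (h : ∀ a, |f a| ≤ c) :
    |expect μ f| ≤ c := by
  rw [abs_le]
  constructor
  · rw [← expect_const μ (-c)]
    exact expect_mono μ fun a => (abs_le.1 (h a)).1
  · rw [← expect_const μ c]
    exact expect_mono μ fun a => (abs_le.1 (h a)).2

theorem expect_comm (μ : PMF α) (ν : PMF β) (f : α → β → ℝ) :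
    expect μ (fun a => expect ν fun b => f a b) = expect ν (fun b => expect μ fun a => f a b) := by
  simp only [expect, Finset.mul_sum]
  rw [Finset.sum_comm]
  exact Finset.sum_congr rfl fun _ _ => Finset.sum_congr rfl fun _ _ => mul_left_comm _ _ _

theorem expect_pure (a : α) (f : α → ℝ) : expect (PMF.pure a) f = f a := by
  classical
  rw [expect, Finset.sum_eq_single a]
  · simp
  · intro b _ hb
    simp [PMF.pure_apply, hb]
  · simp

theorem expect_bind (μ : PMF α) (κ : α → PMF β) (f : β → ℝ) :
    expect (μ.bind κ) f = expect μ fun a => expect (κ a) f := by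
  have h : ∀ b, ((μ.bind κ) b).toReal = ∑ a, (μ a).toReal * (κ a b).toReal := fun b => by
    rw [PMF.bind_apply, tsum_fintype, ENNReal.toReal_sum fun a _ =>
      ENNReal.mul_ne_top (μ.apply_ne_top a) ((κ a).apply_ne_top b)]
    simp only [ENNReal.toReal_mul]
  simp only [expect, h, Finset.sum_mul, Finset.mul_sum]
  rw [Finset.sum_comm]
  simp only [mul_assoc]

theorem expect_map (μ : PMF α) (g : α → β) (f : β → ℝ) :
    expect (μ.map g) f = expect μ fun a => f (g a) := by
  rw [← PMF.bind_pure_comp, expect_bind]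
  simp only [Function.comp_apply, expect_pure]

theorem prob_eq_expect (μ : PMF α) (E : Set α) :
    prob μ E = expect μ (E.indicator fun _ => 1) := by
  rw [prob, PMF.toOuterMeasure_apply, tsum_fintype, ENNReal.toReal_sum]
  · refine Finset.sum_congr rfl fun a _ => ?_
    by_cases h : a ∈ E <;> simp [h]
  · intro a _
    by_cases h : a ∈ E <;> simp [h, μ.apply_ne_top]

theorem prob_singleton {α : Type*} (μ : PMF α) (a : α) : prob μ {a} = (μ a).toReal := by
  rw [prob, PMF.toOuterMeasure_apply_singleton]

/-- The indicator function of `b = 1`. -/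
def Bool.toReal (b : Bool) : ℝ := bif b then 1 else 0

theorem Bool.toReal_nonneg (b : Bool) : 0 ≤ b.toReal := by cases b <;> simp [Bool.toReal]

theorem Bool.toReal_le_one (b : Bool) : b.toReal ≤ 1 := by cases b <;> simp [Bool.toReal]

theorem prob_test (μ : PMF α) (D : α → Bool) :
    prob μ {a | D a = true} = expect μ fun a => (D a).toReal := by
  rw [prob_eq_expect]
  congr 1
  funext a
  cases h : D a <;> simp [h, Bool.toReal]

theorem expect_bern (p : ℝ≥0∞) (hp : p ≤ 1) (f : Bool → ℝ) :
    expect (bern p) f = p.toReal * f true + (1 - p.toReal) * f false := by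
  have h : (1 - p).toReal = 1 - p.toReal := by
    rw [ENNReal.toReal_sub_of_le hp ENNReal.one_ne_top, ENNReal.toReal_one]
  simp [expect, bern, hp, h]

end Expectation

/-! ### The acceptance probability -/

section Acceptance

variable {X Y : Type*} {t : ℕ} {R : X → PMF Y} {R₀ : Bits t → Y} {ε : ℝ}

theorem sampled_apply_pos (R₀ : Bits t → Y) (r : Bits t) : 0 < (sampled R₀ (R₀ r)).toReal := by
  refine ENNReal.toReal_pos ?_ ((sampled R₀).apply_ne_top _)
  rw [← PMF.mem_support_iff, sampled, PMF.mem_support_map_iff]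
  exact ⟨r, by simp [uniformBits], rfl⟩

theorem toReal_acceptProb (x : X) (y : Y) :
    (acceptProb R R₀ ε x y).toReal =
      (R x y).toReal / (Real.exp ε * (sampled R₀ y).toReal) := by
  rw [acceptProb, ENNReal.toReal_div, ENNReal.toReal_mul,
    ENNReal.toReal_ofReal (Real.exp_pos ε).le]

theorem apply_le_of_isDeletionDPWith (hR : IsDeletionDPWith R (sampled R₀) ε 0) (x : X) (y : Y) :
    (R x y).toReal ≤ Real.exp ε * (sampled R₀ y).toReal := by
  have h := (hR x {y}).1
  rw [prob_singleton, prob_singleton, sub_zero, Real.exp_neg] at h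
  exact (inv_mul_le_iff₀ (Real.exp_pos ε)).1 h

theorem toReal_acceptProb_le_one (hR : IsDeletionDPWith R (sampled R₀) ε 0) (x : X) (y : Y) :
    (acceptProb R R₀ ε x y).toReal ≤ 1 := by
  rw [toReal_acceptProb]
  exact div_le_one_of_le₀ (apply_le_of_isDeletionDPWith hR x y)
    (mul_nonneg (Real.exp_pos ε).le ENNReal.toReal_nonneg)

theorem acceptProb_le_one (hR : IsDeletionDPWith R (sampled R₀) ε 0) (x : X) (r : Bits t) :
    acceptProb R R₀ ε x (R₀ r) ≤ 1 := by
  have hpos := sampled_apply_pos R₀ r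
  have htop : acceptProb R R₀ ε x (R₀ r) ≠ ⊤ := by
    refine ENNReal.div_ne_top ((R x).apply_ne_top _) (mul_ne_zero ?_ ?_)
    · simpa using Real.exp_pos ε
    · exact fun h => by simp [h] at hpos
  rw [← ENNReal.toReal_le_toReal htop ENNReal.one_ne_top, ENNReal.toReal_one]
  exact toReal_acceptProb_le_one hR x _

theorem le_toReal_acceptProb (hR : IsDeletionDPWith R (sampled R₀) ε 0) (x : X) (r : Bits t) :
    Real.exp (-(2 * ε)) ≤ (acceptProb R R₀ ε x (R₀ r)).toReal := by
  have h := (hR x {R₀ r}).2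
  rw [prob_singleton, prob_singleton, add_zero] at h
  have hpos := sampled_apply_pos R₀ r
  rw [toReal_acceptProb, le_div_iff₀ (mul_pos (Real.exp_pos ε) hpos)]
  calc Real.exp (-(2 * ε)) * (Real.exp ε * (sampled R₀ (R₀ r)).toReal)
      = Real.exp (-ε) * (sampled R₀ (R₀ r)).toReal := by
        rw [← mul_assoc, ← Real.exp_add]; ring_nf
    _ ≤ Real.exp (-ε) * (Real.exp ε * (R x (R₀ r)).toReal) :=
        mul_le_mul_of_nonneg_left h (Real.exp_pos _).le
    _ = (R x (R₀ r)).toReal := by rw [← mul_assoc, ← Real.exp_add]; simp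

/-- With truly random `r`, acceptance reweights the reference distribution to `e^{-ε} • R x`. -/
theorem expect_acceptProb_mul [Fintype Y] (hR : IsDeletionDPWith R (sampled R₀) ε 0) (x : X)
    (f : Y → ℝ) :
    expect (uniformBits t) (fun r => (acceptProb R R₀ ε x (R₀ r)).toReal * f (R₀ r)) =
      Real.exp (-ε) * expect (R x) f := by
  rw [← expect_map (uniformBits t) R₀ fun y => (acceptProb R R₀ ε x y).toReal * f y]
  change expect (sampled R₀) _ = _
  rw [expect, expect, Finset.mul_sum]
  refine Finset.sum_congr rfl fun y _ => ?_
  rw [toReal_acceptProb, Real.exp_neg]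
  have he := Real.exp_pos ε
  rcases eq_or_ne (sampled R₀ y).toReal 0 with h | h
  · -- The reference distribution dominates `R x`, so both sides vanish.
    have h' := apply_le_of_isDeletionDPWith hR x y
    rw [h, mul_zero] at h'
    rw [le_antisymm h' ENNReal.toReal_nonneg]
    simp
  · field_simp

end Acceptance

/-! ### Single-round tests fooled by the generator -/

namespace Implementation

variable {X Y : Type*} {l t m : ℕ} {R : X → PMF Y} {R₀ : Bits t → Y} {G : Bits l → Bits t} {ε : ℝ}
  {enc : Y ↪ Bits m} (I : Implementation R R₀ G ε enc)

theorem size_add_size_add_one_le_size_circuit (γ : ℝ) (x : X) :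
    I.refCircuit.size + (I.bernCircuit x).size + 1 ≤ (I.circuit γ x).size := by
  have hJ : 1 ≤ rounds ε γ := le_max_left _ _
  have h : ∀ n, 1 ≤ n → I.refCircuit.size + (I.bernCircuit x).size + 1 ≤
      (I.loopCircuit x n).size := by
    rintro (_ | n) hn
    · omega
    · simp only [Circuit.size, loopCircuit, roundCircuit, bitCircuit, Circuit.idle, Circuit.orGate]
      omega
  have := h _ hJ
  simp only [circuit, Circuit.size]
  omega

/-- The circuit on `r` that computes `y = R₀ r`, the bit `b` of the Bernoulli sampler on the fixed
coins `w`, the verdict `d` of `C` on `y`, and finally `op b d`. -/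
def testCircuit (x : X) (w : Bits (I.coins x)) (C : Circuit (Fin m) (Fin 1))
    (op : Bool → Bool → Bool) : Circuit (Fin t) (Fin 1) :=
  .seq I.refCircuit
    (.seq (.wire (Sum.elim (Sum.elim Sum.inl fun j => Sum.inr (w j)) Sum.inl))
      (.seq (.par (I.bernCircuit x) C)
        (.seq (.wire ![Sum.inl (Sum.inl 0), Sum.inl (Sum.inr 0)]) (.gate op))))

theorem size_testCircuit (x : X) (w : Bits (I.coins x)) (C : Circuit (Fin m) (Fin 1))
    (op : Bool → Bool → Bool) :
    (I.testCircuit x w C op).size = I.refCircuit.size + (I.bernCircuit x).size + C.size + 1 := by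
  simp only [testCircuit, Circuit.size]
  omega

theorem eval_testCircuit (x : X) (w : Bits (I.coins x)) (C : Circuit (Fin m) (Fin 1))
    (op : Bool → Bool → Bool) (r : Bits t) :
    (I.testCircuit x w C op).eval r 0 =
      op ((I.bernCircuit x).eval (Sum.elim (enc (R₀ r)) w) 0) (C.eval (enc (R₀ r)) 0) := by
  have h : (fun i => Sum.elim (enc (R₀ r)) id
      ((Sum.elim Sum.inl fun j => Sum.inr (w j) :
        Fin m ⊕ Fin (I.coins x) → Fin m ⊕ Bool) i)) = Sum.elim (enc (R₀ r)) w := by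
    funext j
    rcases j with j | j <;> rfl
  simp only [testCircuit, Circuit.eval, I.eval_refCircuit]
  simp [h]

/-- `G` fools every function `op b d` of the acceptance bit `b` and of the verdict `d` of a small
test. The sampler of `b` is randomized, so this is the pseudorandomness of `G` for each value of
the coins, averaged over the coins. -/
theorem abs_expect_sub_le_of_op {T : ℕ} {β : ℝ} (hG : IsPRG G T β) (x : X)
    (C : Circuit (Fin m) (Fin 1))
    (hC : I.refCircuit.size + (I.bernCircuit x).size + C.size + 1 ≤ T)
    (op : Bool → Bool → Bool) :
    |expect (uniformBits l) (fun s => expect (bern (acceptProb R R₀ ε x (R₀ (G s))))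
          fun b => (op b (C.eval (enc (R₀ (G s))) 0)).toReal) -
        expect (uniformBits t) (fun r => expect (bern (acceptProb R R₀ ε x (R₀ r)))
          fun b => (op b (C.eval (enc (R₀ r)) 0)).toReal)| ≤ β := by
  simp only [← I.law_bernCircuit, expect_map]
  rw [expect_comm, expect_comm (uniformBits t), ← expect_sub]
  refine abs_expect_le _ fun w => ?_
  have h := hG (fun r => (I.testCircuit x w C op).eval r 0)
    ⟨_, (I.size_testCircuit x w C op).trans_le hC, fun _ => rfl⟩
  rw [prob_test, prob_test, expect_map] at h
  simpa only [eval_testCircuit] using h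

/-- `G` fools the value of one round whose continuation after a rejection is worth `v`. -/
theorem abs_expect_sub_le_of_value {T : ℕ} {β : ℝ} (hG : IsPRG G T β)
    (hR : IsDeletionDPWith R (sampled R₀) ε 0) (x : X) (C : Circuit (Fin m) (Fin 1))
    (hC : I.refCircuit.size + (I.bernCircuit x).size + C.size + 1 ≤ T)
    {v : ℝ} (hv0 : 0 ≤ v) (hv1 : v ≤ 1) :
    |expect (uniformBits l) (fun s =>
          (acceptProb R R₀ ε x (R₀ (G s))).toReal * (C.eval (enc (R₀ (G s))) 0).toReal +
            (1 - (acceptProb R R₀ ε x (R₀ (G s))).toReal) * v) -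
        expect (uniformBits t) (fun r =>
          (acceptProb R R₀ ε x (R₀ r)).toReal * (C.eval (enc (R₀ r)) 0).toReal +
            (1 - (acceptProb R R₀ ε x (R₀ r)).toReal) * v)| ≤ β := by
  have h1 := I.abs_expect_sub_le_of_op hG x C hC fun b d => !b || d
  have h0 := I.abs_expect_sub_le_of_op hG x C hC fun b d => b && d
  -- A continuation worth `v` is the mixture of the continuations worth `1` and `0`.
  have key : ∀ r, (acceptProb R R₀ ε x (R₀ r)).toReal * (C.eval (enc (R₀ r)) 0).toReal +
      (1 - (acceptProb R R₀ ε x (R₀ r)).toReal) * v =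
      v * expect (bern (acceptProb R R₀ ε x (R₀ r)))
          (fun b => (!b || C.eval (enc (R₀ r)) 0).toReal) +
        (1 - v) * expect (bern (acceptProb R R₀ ε x (R₀ r)))
          (fun b => (b && C.eval (enc (R₀ r)) 0).toReal) := fun r => by
    rw [expect_bern _ (acceptProb_le_one hR x r), expect_bern _ (acceptProb_le_one hR x r)]
    simp only [Bool.not_true, Bool.false_or, Bool.not_false, Bool.true_or, Bool.true_and,
      Bool.false_and, Bool.toReal, cond_true, cond_false]
    ring
  simp only [key, expect_add, expect_const_mul]
  rw [abs_le] at h0 h1 ⊢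
  constructor <;> nlinarith

end Implementation

/-! ### The rejection loop -/

section Loop

variable {X Y : Type*} {l t : ℕ} {R : X → PMF Y} {R₀ : Bits t → Y} {G : Bits l → Bits t} {ε : ℝ}

theorem expect_rejectionLoop_one (x : X) (s : Bits l)
    (f : Bits l → ℝ) :
    expect (rejectionLoop R R₀ G ε x 1 s) f = expect (uniformBits l) f := by
  simp only [rejectionLoop, Bool.cond_self, PMF.bind_const, PMF.bind_pure]

/-- The recursion for the loop: as some round is left after the first one, the seed that the first
round rejects is overwritten, and the continuation does not depend on it. -/
theorem expect_rejectionLoop_succ_succ (hR : IsDeletionDPWith R (sampled R₀) ε 0) (x : X) (n : ℕ)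
    (s s₀ : Bits l) (f : Bits l → ℝ) :
    expect (rejectionLoop R R₀ G ε x (n + 2) s) f =
      expect (uniformBits l) fun s' =>
        (acceptProb R R₀ ε x (R₀ (G s'))).toReal * f s' +
          (1 - (acceptProb R R₀ ε x (R₀ (G s'))).toReal) *
            expect (rejectionLoop R R₀ G ε x (n + 1) s₀) f := by
  rw [rejectionLoop, expect_bind]
  congr 1
  funext s'
  rw [expect_bind, expect_bern _ (acceptProb_le_one hR x (G s')), cond_true, cond_false,
    expect_pure]
  rfl

/-- If a round accepts with probability `a ∈ [e^{-κ}, e^{κ - 2ε}]`, then the distribution of the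
output is within a factor `e^κ` of the uniform one, whatever the number of rounds. -/
theorem expect_rejectionLoop_bounds (hR : IsDeletionDPWith R (sampled R₀) ε 0) (x : X) {κ : ℝ}
    (hκ : 0 ≤ κ)
    (hlow : Real.exp (-κ) ≤
      expect (uniformBits l) fun s => (acceptProb R R₀ ε x (R₀ (G s))).toReal)
    (hupp : (expect (uniformBits l) fun s => (acceptProb R R₀ ε x (R₀ (G s))).toReal) ≤
      Real.exp (κ - 2 * ε))
    {f : Bits l → ℝ} (hf : ∀ s, 0 ≤ f s) (n : ℕ) (s : Bits l) :
    Real.exp (-κ) * expect (uniformBits l) f ≤ expect (rejectionLoop R R₀ G ε x (n + 1) s) f ∧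
      expect (rejectionLoop R R₀ G ε x (n + 1) s) f ≤
        Real.exp κ * expect (uniformBits l) f := by
  have hF := expect_nonneg (uniformBits l) hf
  induction n with
  | zero =>
    rw [expect_rejectionLoop_one]
    exact ⟨mul_le_of_le_one_left hF (Real.exp_le_one_iff.2 (by linarith)),
      le_mul_of_one_le_left hF (Real.one_le_exp hκ)⟩
  | succ n ih =>
    rw [expect_rejectionLoop_succ_succ hR x n s s]
    set W := expect (rejectionLoop R R₀ G ε x (n + 1) s) f
    set F := expect (uniformBits l) f
    set p := fun s => (acceptProb R R₀ ε x (R₀ (G s))).toReal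
    set a := expect (uniformBits l) fun s => p s
    have hsplit : expect (uniformBits l) (fun s => p s * f s + (1 - p s) * W) =
        expect (uniformBits l) (fun s => p s * f s) + (1 - a) * W :=
      expect_mul_add_one_sub_mul _ _ _ _
    have ha1 : a ≤ 1 := expect_le_one _ fun s => toReal_acceptProb_le_one hR x _
    have hpf : expect (uniformBits l) (fun s => p s * f s) ≤ F :=
      expect_mono _ fun s =>
        mul_le_of_le_one_left (hf s) (toReal_acceptProb_le_one hR x _)
    have hpf' : Real.exp (-(2 * ε)) * F ≤ expect (uniformBits l) (fun s => p s * f s) := by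
      rw [← expect_const_mul]
      exact expect_mono _ fun s =>
        mul_le_mul_of_nonneg_right (le_toReal_acceptProb hR x _) (hf s)
    have h1 : 1 ≤ a * Real.exp κ := by
      have := mul_le_mul_of_nonneg_right hlow (Real.exp_pos κ).le
      rwa [← Real.exp_add, neg_add_cancel, Real.exp_zero] at this
    have h2 : a * Real.exp (-κ) ≤ Real.exp (-(2 * ε)) := by
      have := mul_le_mul_of_nonneg_right hupp (Real.exp_pos (-κ)).le
      rwa [← Real.exp_add, show κ - 2 * ε + -κ = -(2 * ε) by ring] at this
    have h3 := mul_le_mul_of_nonneg_right h1 hF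
    have h4 := mul_le_mul_of_nonneg_right h2 hF
    have h5 := mul_le_mul_of_nonneg_left ih.1 (sub_nonneg.2 ha1)
    have h6 := mul_le_mul_of_nonneg_left ih.2 (sub_nonneg.2 ha1)
    change _ ≤ expect (uniformBits l) (fun s => p s * f s + (1 - p s) * W) ∧
      expect (uniformBits l) (fun s => p s * f s + (1 - p s) * W) ≤ _
    rw [hsplit]
    constructor <;> linarith

/-- The error of the loop as a sampler of `R x`: each of the `n + 1` rounds costs `β`, but only if
it is reached, and the loop runs to its end with probability `(1 - e^{-ε}) ^ (n + 1)`. -/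
theorem abs_expect_rejectionLoop_sub_le {m T : ℕ} [Fintype Y] {enc : Y ↪ Bits m}
    (I : Implementation R R₀ G ε enc) (hε : 0 ≤ ε) {β : ℝ} (hG : IsPRG G T β)
    (hR : IsDeletionDPWith R (sampled R₀) ε 0) (x : X) (C : Circuit (Fin m) (Fin 1))
    (hC : I.refCircuit.size + (I.bernCircuit x).size + C.size + 1 ≤ T) (n : ℕ) (s : Bits l) :
    |expect (rejectionLoop R R₀ G ε x (n + 1) s) (fun s => (C.eval (enc (R₀ (G s))) 0).toReal) -
        expect (R x) (fun y => (C.eval (enc y) 0).toReal)| ≤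
      (1 - Real.exp (-ε)) ^ (n + 1) +
        Real.exp ε * β * (1 - (1 - Real.exp (-ε)) ^ (n + 1)) := by
  set d : Y → ℝ := fun y => (C.eval (enc y) 0).toReal
  set q := expect (R x) d with hq
  set a := Real.exp (-ε) with ha
  have hea : Real.exp ε * a = 1 := by rw [ha, ← Real.exp_add, add_neg_cancel, Real.exp_zero]
  have ha1 : a ≤ 1 := Real.exp_le_one_iff.2 (by linarith)
  have hd0 : ∀ y, 0 ≤ d y := fun y => Bool.toReal_nonneg _
  have hd1 : ∀ y, d y ≤ 1 := fun y => Bool.toReal_le_one _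
  have hq0 : 0 ≤ q := expect_nonneg _ hd0
  have hq1 : q ≤ 1 := expect_le_one _ hd1
  have hacc : expect (uniformBits t) (fun r => (acceptProb R R₀ ε x (R₀ r)).toReal) = a := by
    have := expect_acceptProb_mul hR x fun _ => 1
    simpa only [mul_one, expect_const] using this
  have hdacc := expect_acceptProb_mul hR x d
  rw [← hq, ← ha] at hdacc
  induction n with
  | zero =>
    rw [expect_rejectionLoop_one]
    have h := I.abs_expect_sub_le_of_op hG x C hC fun _ d => d
    simp only [expect_const] at h
    change |expect _ (fun s => d (R₀ (G s))) - expect _ (fun r => d (R₀ r))| ≤ β at h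
    -- Up to the acceptance probability `a`, the reference distribution is a part of `R x`.
    have h' : |expect (uniformBits t) (fun r => d (R₀ r)) - q| ≤ 1 - a := by
      have e : expect (uniformBits t) (fun r => d (R₀ r)) - q =
          expect (uniformBits t) (fun r =>
            (1 - (acceptProb R R₀ ε x (R₀ r)).toReal) * (d (R₀ r) - q)) := by
        have e' : (fun r => (1 - (acceptProb R R₀ ε x (R₀ r)).toReal) * (d (R₀ r) - q)) =
            fun r => d (R₀ r) - (acceptProb R R₀ ε x (R₀ r)).toReal * d (R₀ r) -
              q * (1 - (acceptProb R R₀ ε x (R₀ r)).toReal) := by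
          funext r; ring
        rw [e', expect_sub, expect_sub, expect_const_mul, expect_sub, expect_const, hacc, hdacc]
        ring
      have hb : expect (uniformBits t) (fun r => 1 - (acceptProb R R₀ ε x (R₀ r)).toReal) =
          1 - a := by
        rw [expect_sub, expect_const, hacc]
      rw [e, ← hb, abs_le]
      constructor
      · rw [neg_eq_neg_one_mul, ← expect_const_mul]
        refine expect_mono _ fun r => ?_
        have := toReal_acceptProb_le_one hR x (R₀ r)
        nlinarith [hd0 (R₀ r)]
      · refine expect_mono _ fun r => ?_
        have := toReal_acceptProb_le_one hR x (R₀ r)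
        nlinarith [hd1 (R₀ r)]
    have e : (1 - a) ^ (0 + 1) + Real.exp ε * β * (1 - (1 - a) ^ (0 + 1)) =
        (1 - a) + (Real.exp ε * a) * β := by ring
    rw [e, hea, one_mul, add_comm]
    exact (abs_sub_le _ _ _).trans (add_le_add h h')
  | succ n ih =>
    rw [expect_rejectionLoop_succ_succ hR x n s s]
    set V := expect (rejectionLoop R R₀ G ε x (n + 1) s) (fun s => d (R₀ (G s)))
    have h := I.abs_expect_sub_le_of_value hG hR x C hC
      (v := V) (expect_nonneg _ fun s => hd0 _) (expect_le_one _ fun s => hd1 _)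
    have e : expect (uniformBits t) (fun r =>
        (acceptProb R R₀ ε x (R₀ r)).toReal * d (R₀ r) +
          (1 - (acceptProb R R₀ ε x (R₀ r)).toReal) * V) = q + (1 - a) * (V - q) := by
      rw [expect_mul_add_one_sub_mul, hacc, hdacc]
      ring
    change |_ - expect (uniformBits t) (fun r =>
        (acceptProb R R₀ ε x (R₀ r)).toReal * d (R₀ r) +
          (1 - (acceptProb R R₀ ε x (R₀ r)).toReal) * V)| ≤ β at h
    rw [e] at h
    have h2 : |(1 - a) * (V - q)| ≤ (1 - a) * ((1 - a) ^ (n + 1) +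
        Real.exp ε * β * (1 - (1 - a) ^ (n + 1))) := by
      rw [abs_mul, abs_of_nonneg (sub_nonneg.2 ha1)]
      exact mul_le_mul_of_nonneg_left ih (sub_nonneg.2 ha1)
    have e2 : (1 - a) ^ (n + 1 + 1) + Real.exp ε * β * (1 - (1 - a) ^ (n + 1 + 1)) =
        (Real.exp ε * a) * β + (1 - a) * ((1 - a) ^ (n + 1) +
          Real.exp ε * β * (1 - (1 - a) ^ (n + 1))) := by ring
    rw [e2, hea, one_mul]
    rw [abs_le] at h h2 ⊢
    constructor <;> linarith

end Loop

/-! ### Numerical estimates -/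

/-- On truly random strings, all of the rounds reject with probability at most `γ`. For `γ ≥ 1` the
logarithm in the number of rounds is not positive, and the bound holds as well. -/
theorem one_sub_exp_neg_pow_rounds_le {ε γ : ℝ} (hε : 0 ≤ ε) (hγ : 0 < γ) :
    (1 - Real.exp (-ε)) ^ rounds ε γ ≤ γ := by
  have ha1 : Real.exp (-ε) ≤ 1 := Real.exp_le_one_iff.2 (by linarith)
  have hJ : Real.exp ε * Real.log (1 / γ) ≤ rounds ε γ :=
    (Nat.le_ceil _).trans (by exact_mod_cast le_max_right _ _)
  have h1 : 1 - Real.exp (-ε) ≤ Real.exp (-Real.exp (-ε)) := by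
    linarith [Real.add_one_le_exp (-Real.exp (-ε))]
  have h2 : Real.log (1 / γ) ≤ rounds ε γ * Real.exp (-ε) := by
    have := mul_le_mul_of_nonneg_left hJ (Real.exp_pos (-ε)).le
    rwa [← mul_assoc, ← Real.exp_add, neg_add_cancel, Real.exp_zero, one_mul, mul_comm] at this
  calc (1 - Real.exp (-ε)) ^ rounds ε γ
      ≤ Real.exp (-Real.exp (-ε)) ^ rounds ε γ := pow_le_pow_left₀ (sub_nonneg.2 ha1) h1 _
    _ = Real.exp (-(rounds ε γ * Real.exp (-ε))) := by
        rw [← Real.exp_nat_mul, mul_neg]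
    _ ≤ Real.exp (-Real.log (1 / γ)) := Real.exp_le_exp.2 (neg_le_neg h2)
    _ = γ := by rw [one_div, Real.log_inv, neg_neg, Real.exp_log hγ]

theorem exp_neg_two_mul_le_one_sub {u : ℝ} (h0 : 0 ≤ u) (h1 : u ≤ 1 / 2) :
    Real.exp (-(2 * u)) ≤ 1 - u := by
  have h := Real.add_one_le_exp (2 * u)
  rw [Real.exp_neg]
  refine inv_le_of_inv_le₀ (by linarith) (le_trans ?_ h)
  rw [inv_le_iff_one_le_mul₀ (by linarith)]
  nlinarith

/-- The constant test witnesses that the advantage bound is not negative. -/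
theorem IsPRG.nonneg {l t T : ℕ} {G : Bits l → Bits t} {β : ℝ} (hG : IsPRG G T β) : 0 ≤ β :=
  (abs_nonneg _).trans (hG (fun _ => false) ⟨.wire fun _ => Sum.inr false, Nat.zero_le _,
    fun _ => rfl⟩)

theorem theorem3 {X Y : Type*} {l t m : ℕ}
    (enc : Y ↪ Bits m)
    (R : X → PMF Y) (ρ : PMF Y) (ε : ℝ) (hε : 0 ≤ ε)
    (hR : IsDeletionDPWith R ρ ε 0)
    (R₀ : Bits t → Y) (hR₀ : sampled R₀ = ρ)
    (T : ℕ) (β : ℝ) (G : Bits l → Bits t) (hG : IsPRG G T β)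
    (hβ : β < 1 / (2 * Real.exp ε))
    (γ : ℝ) (hγ : 0 < γ)
    (I : Implementation R R₀ G ε enc)
    (T_R : ℕ) (hT_R : I.RunsInTime γ T_R) (hT : T_R < T) :
    IsDeletionDP (compressor R R₀ G ε γ) (ε + 2 * Real.exp ε * β) 0 ∧
      ∀ x, CompIndistinguishable enc (T - T_R) (γ + Real.exp ε * Real.log (1 / γ) * β)
        ((compressor R R₀ G ε γ x).map fun s => R₀ (G s)) (R x) := by
  subst hR₀
  have : Fintype Y := Fintype.ofInjective enc enc.injective
  have hβ0 := hG.nonneg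
  have he := Real.exp_pos ε
  set u := Real.exp ε * β with hu
  have hu0 : 0 ≤ u := mul_nonneg he.le hβ0
  have hu1 : u ≤ 1 / 2 := by
    rw [lt_div_iff₀ (by positivity)] at hβ
    linarith
  obtain ⟨n, hn⟩ : ∃ n, rounds ε γ = n + 1 :=
    ⟨rounds ε γ - 1, (Nat.sub_add_cancel (le_max_left _ _)).symm⟩
  have hsize : ∀ x (C : Circuit (Fin m) (Fin 1)), C.size ≤ T - T_R →
      I.refCircuit.size + (I.bernCircuit x).size + C.size + 1 ≤ T := fun x C hC => by
    have h1 := I.size_add_size_add_one_le_size_circuit γ x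
    have h2 := hT_R x
    omega
  constructor
  · refine ⟨uniformBits l, fun x E => ?_⟩
    rw [prob_eq_expect, prob_eq_expect, compressor, hn, sub_zero, add_zero]
    have hβu : β = Real.exp (-ε) * u := by
      rw [hu, ← mul_assoc, ← Real.exp_add, neg_add_cancel, Real.exp_zero, one_mul]
    -- The acceptance probability is `e^{-ε}` up to `β`: the test is the acceptance bit alone.
    have hacc := I.abs_expect_sub_le_of_op hG x (.wire fun _ => Sum.inr false)
      (hsize x _ (Nat.zero_le _)) fun b _ => b
    have huni := expect_acceptProb_mul hR x fun _ => 1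
    simp only [expect_bern _ (acceptProb_le_one hR x _), Bool.toReal, cond_true, cond_false,
      mul_zero, add_zero] at hacc
    rw [huni, expect_const, abs_le] at hacc
    simp only [mul_one] at hacc
    have hbounds := expect_rejectionLoop_bounds (G := G) hR x (κ := ε + 2 * Real.exp ε * β)
      (by rw [mul_assoc]; linarith) ?_ ?_
      (f := E.indicator fun _ => 1) (Set.indicator_nonneg fun _ _ => zero_le_one) n
      fun _ => false
    · constructor
      · have h := mul_le_mul_of_nonneg_left hbounds.2 (Real.exp_pos (-(ε + 2 * Real.exp ε * β))).le
        rwa [← mul_assoc, ← Real.exp_add, neg_add_cancel, Real.exp_zero, one_mul] at h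
      · have h := mul_le_mul_of_nonneg_left hbounds.1 (Real.exp_pos (ε + 2 * Real.exp ε * β)).le
        rwa [← mul_assoc, ← Real.exp_add, add_neg_cancel, Real.exp_zero, one_mul] at h
    · rw [mul_assoc, ← hu, neg_add, Real.exp_add]
      have h := mul_le_mul_of_nonneg_left (exp_neg_two_mul_le_one_sub hu0 hu1)
        (Real.exp_pos (-ε)).le
      linarith [hacc.1]
    · have e : ε + 2 * Real.exp ε * β - 2 * ε = -ε + 2 * u := by rw [hu]; ring
      rw [e, Real.exp_add]
      have h := mul_le_mul_of_nonneg_left (Real.add_one_le_exp (2 * u)) (Real.exp_pos (-ε)).le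
      have h' := mul_nonneg (Real.exp_pos (-ε)).le hu0
      linarith [hacc.2]
  · rintro x D ⟨C, hC, hCD⟩
    have h := abs_expect_rejectionLoop_sub_le I hε hG hR x C (hsize x C hC) n fun _ => false
    rw [prob_test, prob_test, expect_map, compressor, hn]
    simp only [hCD] at h
    refine h.trans ?_
    rw [← hn, ← hu]
    have hc := one_sub_exp_neg_pow_rounds_le hε hγ
    have hlog : 1 - γ ≤ Real.log (1 / γ) := by
      rw [one_div, Real.log_inv]
      linarith [Real.log_le_sub_one_of_pos hγ]
    have e : Real.exp ε * Real.log (1 / γ) * β = u * Real.log (1 / γ) := by rw [hu]; ring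
    rw [e]
    -- The bound is increasing in `(1 - e^{-ε}) ^ J`, because its slope `1 - u` is nonnegative.
    nlinarith [mul_le_mul_of_nonneg_left hlog hu0,
      mul_le_mul_of_nonneg_left hc (by linarith : 0 ≤ 1 - u)]
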